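/- \textbf{Setting.} There are $n\ge 1$ products $\mathcal N=\{1,\dots,n\}$; product $i$ has revenue $r_i>0$, preference weight $v_i>0$ and initial inventory $c_i\in\{1,2,\dots\}$, and there are $T\ge 1$ selling periods. A customer who is offered an assortment $S\subseteq\mathcal N$ buys product $i\in S$ with probability $\phi(i,S)=v_i/(1+\sum_{j\in S}v_j)$ and nothing with probability $1/(1+\sum_{j\in S}v_j)$; put $\phi(i,S)=0$ for $i\notin S$. A policy $\pi$ maps each history of the choices made in periods $1,\dots,t-1$ to a probability distribution over assortments; the assortment offered in period $t$ is drawn from it. Let $X^\pi_{it}$ be the number of units of product $i$ sold by the end of period $t$. For $\alpha=1$, BMS-Dynamic is the problem of maximizing $\sum_i r_i\mathbb E[X^\pi_{iT}]$ over policies $\pi$ with $\mathbb P(X^\pi_{iT}\le c_i)=1$ and $\mathbb E[X^\pi_{iT}]\in\{0\}\cup[\max_j\mathbb E[X^\pi_{jT}],\infty)$ for all $i$. Upper-Bound is the problem of maximizing $T\sum_i r_ix_i$ over $(x_0,x_1,\dots,x_n)$ with $x_0+\sum_i x_i=1$ and, for all $i$, $0\le x_i\le v_ix_0$, $x_i\le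 c_i/T$ and $x_i\in\{0\}\cup[\max_j x_j,\infty)$. \textbf{Enumeration algorithm.} For each $\bar x\in\{c_i/T: i\in\mathcal N\}\cup\{v_i/(1+\ell v_i): i\in\mathcal N,\ 1\le\ell\le n\}$ and each $k\in\{1,\dots,n\}$, let $S(\bar x,k)=\{i: c_i\ge T\bar x,\ v_i\ge\bar x/(1-k\bar x)\}$. If $k\bar x<1$ and $|S(\bar x,k)|\ge k$, the candidate for $(\bar x,k)$ has $x_i=\bar x$ for $k$ products $i$ of highest revenue in $S(\bar x,k)$ (ties broken arbitrarily) and $x_i=0$ otherwise; in all other cases the candidate is $x=0$. The algorithm returns a candidate that maximizes $\sum_i r_ix_i$. \textbf{Capping algorithm.} Given an optimal solution $x^*$ of Upper-Bound, let $\bar c=\min\{c_i: x_i^*>0\}$. In each period $t$, given the realized sales $X_{i,t-1}$, set $p_{it}=x_i^*$ if $X_{i,t-1}<\bar c$ and $p_{it}=0$ otherwise, and offer an assortment drawn from a distribution $\pi_t$ over assortments with $\sum_S\phi(i,S)\pi_t(S)=p_{it}$ for all $i$. \textbf{Theorem.} Let $\alpha=1$ and $c_{\min}=\min_i c_i$.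 The enumeration algorithm has an output, and each of its possible outputs $x^*$, with $x_0^*=1-\sum_i x_i^*$, is an optimal solution of Upper-Bound. For every optimal solution $x^*$ of Upper-Bound, the distributions required by the capping algorithm exist, and every policy which the capping algorithm can return is feasible for BMS-Dynamic and is a $\max\{1/2,\,1-1/\sqrt{c_{\min}}\}$-approximation to it: its expected revenue is at least $\max\{1/2,\,1-1/\sqrt{c_{\min}}\}$ times that of every feasible policy. -/

import Mathlib

noncomputable section

namespace BMS

/-- The data of the dynamic assortment problem with products indexed by `Fin n`: revenues `r`,
MNL preference weights `v` (the no-purchase option has weight one), initial inventories `c`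
and the number `T` of time periods. -/
structure Data (n : ℕ) where
  r : Fin n → ℝ
  v : Fin n → ℝ
  c : Fin n → ℕ
  T : ℕ
  r_pos : ∀ i, 0 < r i
  v_pos : ∀ i, 0 < v i
  c_pos : ∀ i, 0 < c i
  T_pos : 0 < T

variable {n : ℕ}

/-- The MNL choice probability `φ(o, S)` under assortment `S`; `none` is the no-purchase
option and `some i` is the purchase of product `i`. -/
def Data.phi (D : Data n) (S : Finset (Fin n)) : Option (Fin n) → ℝ
  | none => 1 / (1 + ∑ j ∈ S, D.v j)
  | some i => if i ∈ S then D.v i / (1 + ∑ j ∈ S, D.v j) else 0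

theorem Data.denom_pos (D : Data n) (S : Finset (Fin n)) : 0 < 1 + ∑ j ∈ S, D.v j :=
  add_pos_of_pos_of_nonneg one_pos (Finset.sum_nonneg fun j _ => (D.v_pos j).le)

theorem Data.phi_nonneg (D : Data n) (S : Finset (Fin n)) (o : Option (Fin n)) :
    0 ≤ D.phi S o := by
  have h := D.denom_pos S
  cases o with
  | none => simp only [Data.phi]; positivity
  | some i =>
    simp only [Data.phi]
    split_ifs
    · exact div_nonneg (D.v_pos i).le h.le
    · exact le_rfl

theorem Data.sum_phi (D : Data n) (S : Finset (Fin n)) : ∑ o, D.phi S o = 1 := by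
  have h := D.denom_pos S
  rw [Fintype.sum_option]
  simp only [Data.phi]
  rw [Finset.sum_ite_mem, Finset.univ_inter, ← Finset.sum_div, ← add_div, div_self h.ne']

/-- The law of the choice of a customer who is offered assortment `S`. -/
def Data.choice (D : Data n) (S : Finset (Fin n)) : PMF (Option (Fin n)) :=
  PMF.ofFintype (fun o => ENNReal.ofReal (D.phi S o)) (by
    rw [← ENNReal.ofReal_sum_of_nonneg fun o _ => D.phi_nonneg S o, D.sum_phi,
      ENNReal.ofReal_one])

/-- A sales history after `t` periods: entry `s` is the choice made in period `s + 1`. -/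
abbrev History (n t : ℕ) : Type := Fin t → Option (Fin n)

/-- The realized sales of product `i` in a history. -/
def sales {t : ℕ} (h : History n t) (i : Fin n) : ℕ :=
  (Finset.univ.filter fun s => h s = some i).card

/-- A dynamic control policy: after every sales history of length `t`, a probability
distribution over the assortments to be offered in period `t + 1`. Only `t < T` matters. -/
abbrev Policy (n : ℕ) : Type := (t : ℕ) → History n t → PMF (Finset (Fin n))

/-- The law of the sales history after `t` periods under a policy. -/
def Data.historyLaw (D : Data n) (p : Policy n) : (t : ℕ) → PMF (History n t)
  | 0 => PMF.pure Fin.elim0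
  | t + 1 => (D.historyLaw p t).bind fun h => (p t h).bind fun S =>
      (D.choice S).map fun o => Fin.snoc (α := fun _ => Option (Fin n)) h o

/-- The expected sales of product `i` over the whole horizon. -/
def Data.expectedSales (D : Data n) (p : Policy n) (i : Fin n) : ℝ :=
  ∑ h : History n D.T, (D.historyLaw p D.T h).toReal * (sales h i : ℝ)

/-- The expected total revenue of a policy. -/
def Data.revenue (D : Data n) (p : Policy n) : ℝ :=
  ∑ i, D.r i * D.expectedSales p i

/-- The market share balancing constraint with parameter `α`: every entry is zero or at least
`α` times the largest entry. -/
def Balanced (α : ℝ) (y : Fin n → ℝ) : Prop :=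
  ∀ i, y i ∈ ({0} ∪ Set.Ici (α * ⨆ j, y j) : Set ℝ)

/-- Feasibility of a policy for the dynamic problem with balancing parameter `α`: sales never
exceed inventory, with probability one, and expected sales are balanced. -/
structure Data.DynamicFeasible (D : Data n) (α : ℝ) (p : Policy n) : Prop where
  inventory : ∀ i, (D.historyLaw p D.T).toOuterMeasure {h | sales h i ≤ D.c i} = 1
  balanced : Balanced α (D.expectedSales p)

/-- The policy `p` is a `θ`-approximation to the dynamic problem: it is feasible, and its
expected revenue is at least `θ` times that of every feasible policy. -/
structure Data.DynamicApprox (D : Data n) (α θ : ℝ) (p : Policy n) : Prop where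
  feasible : D.DynamicFeasible α p
  ratio : ∀ p' : Policy n, D.DynamicFeasible α p' → θ * D.revenue p' ≤ D.revenue p

/-- Feasibility for the upper bound problem. -/
structure Data.UpperFeasible (D : Data n) (α x₀ : ℝ) (x : Fin n → ℝ) : Prop where
  total : x₀ + ∑ i, x i = 1
  nonneg : ∀ i, 0 ≤ x i
  le_weight : ∀ i, x i ≤ D.v i * x₀
  le_inventory : ∀ i, x i ≤ (D.c i : ℝ) / D.T
  balanced : Balanced α x

/-- Optimality for the upper bound problem, which maximizes `T * ∑ i, r i * x i`. -/
structure Data.UpperOptimal (D : Data n) (α x₀ : ℝ) (x : Fin n → ℝ) : Prop where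
  feasible : D.UpperFeasible α x₀ x
  optimal : ∀ (y₀ : ℝ) (y : Fin n → ℝ), D.UpperFeasible α y₀ y →
    (D.T : ℝ) * ∑ i, D.r i * y i ≤ (D.T : ℝ) * ∑ i, D.r i * x i

/-! The enumeration algorithm for the upper bound problem when `α = 1`. -/

/-- The values of `x̄` which the algorithm enumerates. -/
def Data.grid (D : Data n) : Set ℝ :=
  {a | ∃ i, a = (D.c i : ℝ) / D.T} ∪
  {a | ∃ i, ∃ l ∈ Finset.Icc 1 n, a = D.v i / (1 + (l : ℝ) * D.v i)}

/-- The set `S(x̄, k)` of products eligible for purchase probability `x̄`. -/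
def Data.eligible (D : Data n) (a : ℝ) (k : ℕ) : Finset (Fin n) :=
  open Classical in
  Finset.univ.filter fun i => (D.T : ℝ) * a ≤ D.c i ∧ a / (1 - (k : ℝ) * a) ≤ D.v i

/-- `A` consists of `k` products of `S` with the highest revenues. -/
def Data.IsTop (D : Data n) (S : Finset (Fin n)) (k : ℕ) (A : Finset (Fin n)) : Prop :=
  A ⊆ S ∧ A.card = k ∧ ∀ i ∈ A, ∀ j ∈ S, j ∉ A → D.r j ≤ D.r i

/-- `top` is a rule that selects `k` products of highest revenue in `S(x̄, k)` whenever there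
are at least `k` products in it; ties in revenue may be broken in any way. -/
def Data.IsTopRule (D : Data n) (top : ℝ → ℕ → Finset (Fin n)) : Prop :=
  ∀ a k, k ≤ (D.eligible a k).card → D.IsTop (D.eligible a k) k (top a k)

/-- The candidate solution for `(x̄, k)`. In the cases in which the algorithm only records the
revenue zero, it is the zero vector. -/
def Data.candidate (D : Data n) (top : ℝ → ℕ → Finset (Fin n)) (a : ℝ) (k : ℕ) : Fin n → ℝ :=
  open Classical in
  if 1 ≤ (k : ℝ) * a then 0
  else if (D.eligible a k).card < k then 0
  else fun i => if i ∈ top a k then a else 0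

/-- The vector `x` may be returned by the enumeration algorithm: it is a candidate of maximum
revenue over all enumerated pairs `(x̄, k)`, for some rule of breaking ties. -/
def Data.EnumOutput (D : Data n) (x : Fin n → ℝ) : Prop :=
  ∃ top, D.IsTopRule top ∧ ∃ a ∈ D.grid, ∃ k ∈ Finset.Icc 1 n, x = D.candidate top a k ∧
    ∀ a' ∈ D.grid, ∀ k' ∈ Finset.Icc 1 n,
      ∑ i, D.r i * D.candidate top a' k' i ≤ ∑ i, D.r i * x i

/-! The capped policy. -/

/-- The smallest initial inventory. -/
def Data.cMin (D : Data n) : ℕ := sInf {m | ∃ i, D.c i = m}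

/-- The smallest initial inventory of a product with positive purchase probability. -/
def Data.cBar (D : Data n) (x : Fin n → ℝ) : ℕ := sInf {m | ∃ i, 0 < x i ∧ D.c i = m}

/-- The purchase probability of product `i` under a distribution over assortments. -/
def Data.purchaseProb (D : Data n) (q : PMF (Finset (Fin n))) (i : Fin n) : ℝ :=
  ∑ S, (q S).toReal * D.phi S (some i)

/-- The policy `p` is one that the capping algorithm may return from `x`: in every period and
after every history, it offers a distribution over assortments under which the purchase
probability of product `i` is `x i` while the sales of `i` are below the cap, else zero. -/
def Data.IsCapped (D : Data n) (x : Fin n → ℝ) (p : Policy n) : Prop :=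
  ∀ t < D.T, ∀ (h : History n t) (i : Fin n),
    D.purchaseProb (p t h) i = if sales h i < D.cBar x then x i else 0

end BMS

end

/-!
The time-averaged expected sales `E[X_{iT}] / T` of a feasible policy are feasible for the upper
bound problem (`DynamicFeasible.upperFeasible`): in every period a purchase probability is at most
`v i` times the no-purchase probability, and averaging preserves this. So the optimal value
`T * ∑ r i * x i` bounds the revenue of every feasible policy.

Under a capped policy the sales of one product form a Markov chain that moves up with probability
`x i` until it reaches the cap (`IsCapped.mean_sales`). For `α = 1` all positive `x i` equal one
number `a`, so all products with `x i > 0` have the same law of sales. This gives balance, and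
reduces the approximation ratio to a bound on `E[min(B, c)]` for a binomial variable `B` of mean
`μ = T * a ≤ c`. From `max z 0 ≤ (z + s)² / (4 * s)` at `z = B - c`, with
`s = (c - μ) + μ / √c`, and `Var B ≤ μ`, one gets
`E[min(B, c)] ≥ (1 - 1 / (2 * √c)) * μ` (`mul_le_capStep_iterate`). This single bound implies both
terms of the maximum, since `c ≥ 1`. The quadratic bound is carried through the recursion of the
capped chain itself, so that no binomial law is needed.

The required distributions over assortments come from independent coins: reweighting the
probability that the coins select `S` by `1 + ∑ j ∈ S, v j` cancels the MNL denominator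
(`exists_purchaseProb_eq`).

For the enumeration algorithm, a feasible vector is determined by its support and its common
positive value; increasing that value until a constraint binds ends at a grid point, where the
candidate is at least as good (`exists_candidate_ge`).
-/

namespace BMS

variable {n : ℕ}

/-! ### Expectations under finitely supported laws -/

section Mean

variable {α β : Type*} [Fintype α] [Fintype β]

/-- The expectation of `f` under the law `μ` on a finite type. -/
noncomputable def mean (μ : PMF α) (f : α → ℝ) : ℝ := ∑ a, (μ a).toReal * f a

theorem sum_toReal (μ : PMF α) : ∑ a, (μ a).toReal = 1 := by
  rw [← ENNReal.toReal_sum (fun a _ => μ.apply_ne_top a), ← tsum_fintype (L := .unconditional _),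
    μ.tsum_coe, ENNReal.toReal_one]

theorem mean_mono (μ : PMF α) {f g : α → ℝ} (h : ∀ a, f a ≤ g a) : mean μ f ≤ mean μ g :=
  Finset.sum_le_sum fun a _ => mul_le_mul_of_nonneg_left (h a) ENNReal.toReal_nonneg

theorem mean_const (μ : PMF α) (b : ℝ) : mean μ (fun _ => b) = b := by
  rw [mean, ← Finset.sum_mul, sum_toReal, one_mul]

theorem mean_add (μ : PMF α) (f g : α → ℝ) :
    mean μ (fun a => f a + g a) = mean μ f + mean μ g := by
  simp only [mean, mul_add, Finset.sum_add_distrib]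

theorem mean_sub (μ : PMF α) (f g : α → ℝ) :
    mean μ (fun a => f a - g a) = mean μ f - mean μ g := by
  simp only [mean, mul_sub, Finset.sum_sub_distrib]

theorem mean_const_mul (μ : PMF α) (b : ℝ) (f : α → ℝ) :
    mean μ (fun a => b * f a) = b * mean μ f := by
  simp only [mean, Finset.mul_sum, mul_left_comm]

theorem mean_mul_const (μ : PMF α) (b : ℝ) (f : α → ℝ) :
    mean μ (fun a => f a * b) = mean μ f * b := by
  simp only [mean, Finset.sum_mul, mul_assoc]

theorem mean_sum {ι : Type*} (μ : PMF α) (s : Finset ι) (f : ι → α → ℝ) :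
    mean μ (fun a => ∑ i ∈ s, f i a) = ∑ i ∈ s, mean μ (f i) := by
  simp only [mean, Finset.mul_sum]
  exact Finset.sum_comm

theorem mean_congr_support (μ : PMF α) {f g : α → ℝ} (h : ∀ a ∈ μ.support, f a = g a) :
    mean μ f = mean μ g := by
  refine Finset.sum_congr rfl fun a _ => ?_
  by_cases ha : μ a = 0
  · simp [ha]
  · rw [h a ((μ.mem_support_iff a).2 ha)]

theorem mean_pure (a : α) (f : α → ℝ) : mean (PMF.pure a) f = f a := by
  classical
  rw [mean, Finset.sum_eq_single a]
  · simp
  · intro b _ hb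
    simp [hb]
  · simp

theorem mean_bind (μ : PMF α) (k : α → PMF β) (f : β → ℝ) :
    mean (μ.bind k) f = mean μ fun a => mean (k a) f := by
  have h : ∀ b, ((μ.bind k) b).toReal = ∑ a, (μ a).toReal * (k a b).toReal := by
    intro b
    rw [PMF.bind_apply, tsum_fintype, ENNReal.toReal_sum]
    · simp only [ENNReal.toReal_mul]
    · exact fun a _ => ENNReal.mul_ne_top (μ.apply_ne_top a) ((k a).apply_ne_top b)
  simp only [mean, h, Finset.sum_mul, Finset.mul_sum, mul_assoc]
  exact Finset.sum_comm

theorem mean_map (μ : PMF α) (g : α → β) (f : β → ℝ) :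
    mean (μ.map g) f = mean μ fun a => f (g a) := by
  rw [PMF.map, mean_bind]
  simp only [Function.comp, mean_pure]

/-- An event whose complement has mean zero has probability one. -/
theorem toOuterMeasure_eq_one_of_mean_eq_zero (μ : PMF α) {s : Set α} {f : α → ℝ}
    (hf : ∀ a, 0 ≤ f a) (hs : ∀ a ∉ s, 0 < f a) (h : mean μ f = 0) :
    μ.toOuterMeasure s = 1 := by
  rw [PMF.toOuterMeasure_apply_eq_one_iff]
  intro a ha
  by_contra has
  have h0 := (Finset.sum_eq_zero_iff_of_nonneg fun b _ =>
    mul_nonneg ENNReal.toReal_nonneg (hf b)).1 h a (Finset.mem_univ a)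
  exact (mul_pos (ENNReal.toReal_pos ((μ.mem_support_iff a).1 ha) (μ.apply_ne_top a))
    (hs a has)).ne' h0

end Mean

/-! ### One period of sales -/

theorem Data.mean_choice (D : Data n) (S : Finset (Fin n)) (f : Option (Fin n) → ℝ) :
    mean (D.choice S) f = ∑ o, D.phi S o * f o := by
  refine Finset.sum_congr rfl fun o _ => ?_
  rw [Data.choice, PMF.ofFintype_apply, ENNReal.toReal_ofReal (D.phi_nonneg S o)]

theorem sales_snoc {t : ℕ} (h : History n t) (o : Option (Fin n)) (i : Fin n) :
    sales (Fin.snoc (α := fun _ => Option (Fin n)) h o : History n (t + 1)) i =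
      sales h i + if o = some i then 1 else 0 := by
  simp only [sales, Finset.card_filter, Fin.sum_univ_castSucc, Fin.snoc_castSucc, Fin.snoc_last]

/-- Offering a random assortment moves the sales of `i` up by one with probability
`purchaseProb`, and leaves them unchanged otherwise. -/
theorem Data.mean_sales_succ (D : Data n) (p : Policy n) (t : ℕ) (i : Fin n) (f : ℕ → ℝ) :
    mean (D.historyLaw p (t + 1)) (fun h => f (sales h i)) =
      mean (D.historyLaw p t) fun h => f (sales h i) +
        D.purchaseProb (p t h) i * (f (sales h i + 1) - f (sales h i)) := by
  rw [Data.historyLaw, mean_bind]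
  congr 1
  funext h
  rw [mean_bind]
  have hS : ∀ S, mean ((D.choice S).map fun o =>
      (Fin.snoc (α := fun _ => Option (Fin n)) h o : History n (t + 1)))
        (fun h => f (sales h i)) =
      f (sales h i) + D.phi S (some i) * (f (sales h i + 1) - f (sales h i)) := by
    intro S
    rw [mean_map, D.mean_choice]
    have ho : ∀ o, D.phi S o *
        f (sales (Fin.snoc (α := fun _ => Option (Fin n)) h o : History n (t + 1)) i) =
        D.phi S o * f (sales h i) +
          if o = some i then D.phi S o * (f (sales h i + 1) - f (sales h i)) else 0 := by
      intro o
      rw [sales_snoc]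
      split_ifs
      · ring
      · simp
    rw [Finset.sum_congr rfl fun o _ => ho o, Finset.sum_add_distrib, ← Finset.sum_mul, D.sum_phi,
      one_mul, Finset.sum_ite_eq' Finset.univ (some i)]
    simp
  simp only [hS]
  rw [mean_add, mean_const, mean_mul_const]
  rfl

theorem Data.expectedSales_eq_mean (D : Data n) (p : Policy n) (i : Fin n) :
    D.expectedSales p i = mean (D.historyLaw p D.T) fun h => (sales h i : ℝ) := rfl

theorem Data.expectedSales_nonneg (D : Data n) (p : Policy n) (i : Fin n) :
    0 ≤ D.expectedSales p i :=
  Finset.sum_nonneg fun _ _ => mul_nonneg ENNReal.toReal_nonneg (Nat.cast_nonneg _)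

/-! ### Balanced vectors -/

/-- For `α = 1`, a nonnegative vector is balanced exactly when its positive entries agree. -/
theorem balanced_one_iff {y : Fin n → ℝ} (hy : ∀ i, 0 ≤ y i) :
    Balanced 1 y ↔ ∀ i j, 0 < y i → 0 < y j → y i = y j := by
  have hb : BddAbove (Set.range y) := Set.finite_range y |>.bddAbove
  constructor
  · intro h
    have key : ∀ i j, 0 < y i → y j ≤ y i := by
      intro i j hi
      rcases h i with h0 | h1
      · exact absurd h0 hi.ne'
      · rw [one_mul] at h1
        exact (le_ciSup hb j).trans h1
    exact fun i j hi hj => le_antisymm (key j i hj) (key i j hi)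
  · intro h i
    rcases (hy i).eq_or_lt with h0 | h0
    · exact Or.inl h0.symm
    · refine Or.inr ?_
      have : Nonempty (Fin n) := ⟨i⟩
      rw [Set.mem_Ici, one_mul]
      refine ciSup_le fun j => ?_
      rcases (hy j).eq_or_lt with hj | hj
      · rw [← hj]
        exact hy i
      · exact (h j i hj h0).le

/-! ### The upper bound on feasible policies -/

/-- Each MNL purchase probability is at most the weight times the no-purchase probability. -/
theorem Data.phi_some_le (D : Data n) (S : Finset (Fin n)) (i : Fin n) :
    D.phi S (some i) ≤ D.v i * (1 - ∑ j, D.phi S (some j)) := by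
  have h := D.sum_phi S
  rw [Fintype.sum_option] at h
  rw [show 1 - ∑ j, D.phi S (some j) = D.phi S none by linarith]
  have hd := D.denom_pos S
  simp only [Data.phi]
  split_ifs
  · rw [mul_one_div]
  · exact mul_nonneg (D.v_pos i).le (by positivity)

theorem Data.purchaseProb_le (D : Data n) (q : PMF (Finset (Fin n))) (i : Fin n) :
    D.purchaseProb q i ≤ D.v i * (1 - ∑ j, D.purchaseProb q j) := by
  have h := mean_mono q fun S => D.phi_some_le S i
  rw [mean_const_mul, mean_sub, mean_const, mean_sum] at h
  exact h

theorem Data.mean_sales_le (D : Data n) (p : Policy n) (i : Fin n) (t : ℕ) :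
    mean (D.historyLaw p t) (fun h => (sales h i : ℝ)) ≤
      D.v i * (t - ∑ j, mean (D.historyLaw p t) fun h => (sales h j : ℝ)) := by
  induction t with
  | zero => simp [Data.historyLaw, mean_pure, sales]
  | succ t ih =>
    have hs : ∀ j, mean (D.historyLaw p (t + 1)) (fun h => (sales h j : ℝ)) =
        mean (D.historyLaw p t) (fun h => (sales h j : ℝ)) +
          mean (D.historyLaw p t) fun h => D.purchaseProb (p t h) j := by
      intro j
      rw [D.mean_sales_succ p t j (fun m => (m : ℝ)), ← mean_add]
      simp
    have h := mean_mono (D.historyLaw p t) fun h => D.purchaseProb_le (p t h) i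
    rw [mean_const_mul, mean_sub, mean_const, mean_sum] at h
    simp only [hs, Finset.sum_add_distrib]
    push_cast
    linarith

/-- The time-averaged expected sales of a feasible policy are feasible for the upper bound
problem. -/
theorem Data.DynamicFeasible.upperFeasible {D : Data n} {p : Policy n}
    (hp : D.DynamicFeasible 1 p) :
    D.UpperFeasible 1 (1 - ∑ i, D.expectedSales p i / D.T) fun i => D.expectedSales p i / D.T := by
  have hT : (0 : ℝ) < D.T := Nat.cast_pos.2 D.T_pos
  have h0 := D.expectedSales_nonneg p
  refine ⟨by ring, fun i => div_nonneg (h0 i) hT.le, fun i => ?_, fun i => ?_, ?_⟩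
  · have h := D.mean_sales_le p i D.T
    simp only [← D.expectedSales_eq_mean] at h
    rw [← Finset.sum_div, div_le_iff₀ hT]
    refine h.trans_eq ?_
    field_simp
  · refine div_le_div_of_nonneg_right ?_ hT.le
    have hsub := (PMF.toOuterMeasure_apply_eq_one_iff _ _).1 (hp.inventory i)
    have hmin : D.expectedSales p i =
        mean (D.historyLaw p D.T) fun h => min (sales h i : ℝ) (D.c i) := by
      rw [D.expectedSales_eq_mean]
      exact mean_congr_support _ fun h hh => (min_eq_left (Nat.cast_le.2 (hsub hh))).symm
    rw [hmin]
    refine (mean_mono _ fun h => min_le_right _ _).trans_eq (mean_const _ _)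
  · rw [balanced_one_iff fun i => div_nonneg (h0 i) hT.le]
    intro i j hi hj
    rw [div_pos_iff_of_pos_right hT] at hi hj
    rw [(balanced_one_iff h0).1 hp.balanced i j hi hj]

theorem Data.UpperOptimal.revenue_le {D : Data n} {x₀ : ℝ} {x : Fin n → ℝ}
    (hx : D.UpperOptimal 1 x₀ x) {p : Policy n} (hp : D.DynamicFeasible 1 p) :
    D.revenue p ≤ D.T * ∑ i, D.r i * x i := by
  have hT : (D.T : ℝ) ≠ 0 := Nat.cast_ne_zero.2 D.T_pos.ne'
  refine le_trans (le_of_eq ?_) (hx.optimal _ _ hp.upperFeasible)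
  rw [Data.revenue, Finset.mul_sum]
  refine Finset.sum_congr rfl fun i _ => ?_
  field_simp

/-! ### Realizing purchase probabilities by random assortments -/

/-- Independent inclusion weights: `S` receives the probability that independent coins with
success probabilities `u i` succeed exactly on `S`. -/
noncomputable def coinWeight (u : Fin n → ℝ) (S : Finset (Fin n)) : ℝ :=
  (∏ i ∈ S, u i) * ∏ i ∈ Finset.univ \ S, (1 - u i)

theorem sum_coinWeight (u : Fin n → ℝ) : ∑ S, coinWeight u S = 1 := by
  have h := Finset.prod_add u (fun i => 1 - u i) Finset.univ
  rw [Finset.powerset_univ] at h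
  simp only [coinWeight, ← h]
  simp

theorem sum_coinWeight_mem (u : Fin n → ℝ) (i : Fin n) :
    ∑ S, (if i ∈ S then coinWeight u S else 0) = u i := by
  -- Replacing the failure weight of `i` by zero kills exactly the assortments without `i`.
  have h := Finset.prod_add u (fun j => if j = i then 0 else 1 - u j) Finset.univ
  rw [Finset.powerset_univ] at h
  have hl : ∏ j, (u j + if j = i then 0 else 1 - u j) = u i := by
    rw [Finset.prod_eq_single i]
    · simp
    · intro j _ hj
      simp [hj]
    · simp
  rw [← hl, h]
  refine Finset.sum_congr rfl fun S _ => ?_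
  split_ifs with hi
  · rw [coinWeight]
    congr 1
    refine Finset.prod_congr rfl fun j hj => ?_
    rw [if_neg]
    rintro rfl
    exact (Finset.mem_sdiff.1 hj).2 hi
  · have h0 : (∏ j ∈ Finset.univ \ S, if j = i then 0 else 1 - u j) = 0 :=
      Finset.prod_eq_zero (i := i) (by simp [hi]) (if_pos rfl)
    rw [h0, mul_zero]

/-- Every vector of purchase probabilities with `p i ≤ v i * p₀` is the mean MNL choice under
some distribution over assortments: with `u i = p i / (v i * p₀)`, give `S` the weight
`p₀ * (1 + ∑ j ∈ S, v j) * coinWeight u S`. -/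
theorem Data.exists_purchaseProb_eq (D : Data n) {p₀ : ℝ} {p : Fin n → ℝ} (hp₀ : 0 < p₀)
    (hsum : p₀ + ∑ i, p i = 1) (hp : ∀ i, 0 ≤ p i) (hle : ∀ i, p i ≤ D.v i * p₀) :
    ∃ q : PMF (Finset (Fin n)), ∀ i, D.purchaseProb q i = p i := by
  set u : Fin n → ℝ := fun i => p i / (D.v i * p₀) with hu
  have hvp : ∀ i, 0 < D.v i * p₀ := fun i => mul_pos (D.v_pos i) hp₀
  have hw : ∀ S, 0 ≤ coinWeight u S := fun S => mul_nonneg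
    (Finset.prod_nonneg fun i _ => div_nonneg (hp i) (hvp i).le)
    (Finset.prod_nonneg fun i _ => sub_nonneg.2 ((div_le_one (hvp i)).2 (hle i)))
  have hui : ∀ i, p₀ * (D.v i * u i) = p i := by
    intro i
    have := (hvp i).ne'
    have := (D.v_pos i).ne'
    simp only [hu]
    field_simp
  set w : Finset (Fin n) → ℝ := fun S => p₀ * ((1 + ∑ j ∈ S, D.v j) * coinWeight u S) with hwdef
  have hwn : ∀ S, 0 ≤ w S := fun S =>
    mul_nonneg hp₀.le (mul_nonneg (D.denom_pos S).le (hw S))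
  have hws : ∑ S, w S = 1 := by
    have : ∀ S, w S = p₀ * coinWeight u S +
        ∑ j, p₀ * (D.v j * if j ∈ S then coinWeight u S else 0) := by
      intro S
      simp only [hwdef, add_mul, one_mul, mul_add, ← Finset.mul_sum, mul_ite, mul_zero,
        Finset.sum_ite_mem, Finset.univ_inter, Finset.sum_mul]
    simp only [this, Finset.sum_add_distrib]
    rw [Finset.sum_comm, ← Finset.mul_sum, sum_coinWeight, mul_one]
    simp only [← Finset.mul_sum, sum_coinWeight_mem]
    rw [Finset.mul_sum]
    simp only [hui]
    exact hsum
  refine ⟨PMF.ofFintype (fun S => ENNReal.ofReal (w S)) ?_, fun i => ?_⟩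
  · rw [← ENNReal.ofReal_sum_of_nonneg fun S _ => hwn S, hws, ENNReal.ofReal_one]
  · have hterm : ∀ S, w S * D.phi S (some i) =
        p₀ * (D.v i * if i ∈ S then coinWeight u S else 0) := by
      intro S
      have hd := (D.denom_pos S).ne'
      simp only [hwdef, Data.phi]
      split_ifs
      · field_simp
      · simp
    simp only [Data.purchaseProb, PMF.ofFintype_apply, ENNReal.toReal_ofReal (hwn _), hterm,
      ← Finset.mul_sum, sum_coinWeight_mem]
    exact hui i

theorem Data.UpperFeasible.pos {D : Data n} {α x₀ : ℝ} {x : Fin n → ℝ}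
    (hx : D.UpperFeasible α x₀ x) : 0 < x₀ := by
  by_contra! h
  have h0 : ∀ i, x i ≤ 0 := fun i =>
    (hx.le_weight i).trans (mul_nonpos_of_nonneg_of_nonpos (D.v_pos i).le h)
  have := hx.total
  have := Finset.sum_nonpos fun i (_ : i ∈ Finset.univ) => h0 i
  linarith

theorem Data.UpperFeasible.exists_isCapped {D : Data n} {α x₀ : ℝ} {x : Fin n → ℝ}
    (hx : D.UpperFeasible α x₀ x) : ∃ p : Policy n, D.IsCapped x p := by
  have key : ∀ (t : ℕ) (h : History n t), ∃ q : PMF (Finset (Fin n)),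
      ∀ i, D.purchaseProb q i = if sales h i < D.cBar x then x i else 0 := by
    intro t h
    set y : Fin n → ℝ := fun i => if sales h i < D.cBar x then x i else 0 with hy
    have hy0 : ∀ i, 0 ≤ y i := by
      intro i
      simp only [hy]
      split_ifs
      exacts [hx.nonneg i, le_rfl]
    have hyx : ∀ i, y i ≤ x i := by
      intro i
      simp only [hy]
      split_ifs
      exacts [le_rfl, hx.nonneg i]
    have hsum := Finset.sum_le_sum fun i (_ : i ∈ Finset.univ) => hyx i
    have htot := hx.total
    have hle : x₀ ≤ 1 - ∑ i, y i := by linarith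
    exact D.exists_purchaseProb_eq (hx.pos.trans_le hle) (by ring) hy0 fun i =>
      ((hyx i).trans (hx.le_weight i)).trans (mul_le_mul_of_nonneg_left hle (D.v_pos i).le)
  choose q hq using key
  exact ⟨q, fun t _ h i => hq t h i⟩

/-! ### The capped counting chain -/

/-- The transition operator of the Markov chain on `ℕ` that moves up by one with probability
`a` while it is below `c`, and stays put from `c` on. -/
noncomputable def capStep (a : ℝ) (c : ℕ) (f : ℕ → ℝ) : ℕ → ℝ := fun m =>
  if m < c then f m + a * (f (m + 1) - f m) else f m

/-- Under a capped policy the sales of each single product form the capped counting chain,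
whatever the dependence between the products. -/
theorem Data.IsCapped.mean_sales {D : Data n} {x : Fin n → ℝ} {p : Policy n}
    (hp : D.IsCapped x p) (i : Fin n) {t : ℕ} (ht : t ≤ D.T) (f : ℕ → ℝ) :
    mean (D.historyLaw p t) (fun h => f (sales h i)) = (capStep (x i) (D.cBar x))^[t] f 0 := by
  induction t generalizing f with
  | zero => simp [Data.historyLaw, mean_pure, sales]
  | succ t ih =>
    rw [D.mean_sales_succ, Function.iterate_succ_apply, ← ih (by omega)]
    congr 1
    funext h
    rw [hp t (by omega) h i, capStep]
    split_ifs <;> ring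

theorem capStep_iterate_eq_zero {a : ℝ} {c k : ℕ} (hc : c ≤ k ∨ a = 0) {f : ℕ → ℝ}
    (hf : ∀ m ≤ k, f m = 0) (t : ℕ) : ∀ m ≤ k, (capStep a c)^[t] f m = 0 := by
  induction t with
  | zero => exact hf
  | succ t ih =>
    intro m hm
    rw [Function.iterate_succ_apply', capStep, ih m hm]
    split_ifs with hmc
    · rcases hc with hc | ha
      · rw [ih (m + 1) (by omega)]
        ring
      · rw [ha]
        ring
    · rfl

/-- The capped chain agrees with the uncapped one on functions that are constant from `c` on.
Hence it dominates the uncapped Bernoulli random walk on quadratic minorants of such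
functions, for which the first two moments are explicit. -/
theorem le_capStep_iterate {a : ℝ} (ha : 0 ≤ a) (ha1 : a ≤ 1) (c : ℕ) (s b : ℝ) {f : ℕ → ℝ}
    (hf : ∀ m, c ≤ m → f (m + 1) = f m)
    (hq : ∀ m : ℕ, (m : ℝ) - b * (m - c + s) ^ 2 ≤ f m) (t : ℕ) (m : ℕ) :
    (m + t * a : ℝ) - b * ((m + t * a - c + s) ^ 2 + t * a * (1 - a)) ≤
      (capStep a c)^[t] f m := by
  have hconst : ∀ t m, c ≤ m → (capStep a c)^[t] f (m + 1) = (capStep a c)^[t] f m := by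
    intro t
    induction t with
    | zero => exact hf
    | succ t ih =>
      intro m hm
      rw [Function.iterate_succ_apply', capStep, capStep, if_neg (by omega), if_neg (by omega),
        ih m hm]
  induction t generalizing m with
  | zero =>
    refine le_trans (le_of_eq ?_) (hq m)
    push_cast
    ring
  | succ t ih =>
    have h0 := ih m
    have h1 := ih (m + 1)
    have hstep : (capStep a c)^[t + 1] f m =
        (1 - a) * (capStep a c)^[t] f m + a * (capStep a c)^[t] f (m + 1) := by
      rw [Function.iterate_succ_apply', capStep]
      split_ifs with hmc
      · ring
      · rw [hconst t m (by omega)]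
        ring
    rw [hstep]
    have := add_le_add (mul_le_mul_of_nonneg_left h0 (sub_nonneg.2 ha1))
      (mul_le_mul_of_nonneg_left h1 ha)
    refine le_trans (le_of_eq ?_) this
    push_cast
    ring

/-- If the mean `T * a` of the uncapped walk is at most the cap `c`, then capping loses at most
the fraction `1 / (2 * √c)` of it. -/
theorem mul_le_capStep_iterate {a : ℝ} (ha : 0 < a) (ha1 : a ≤ 1) {c T : ℕ} (hc : 0 < c)
    (hT : 0 < T) (hTa : T * a ≤ c) :
    (1 - 1 / (2 * √c)) * (T * a) ≤ (capStep a c)^[T] (fun m => min (m : ℝ) c) 0 := by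
  have hcr : (1 : ℝ) ≤ c := by exact_mod_cast hc
  have hTr : (0 : ℝ) < T := by exact_mod_cast hT
  set w : ℝ := √c with hw
  have hw1 : 1 ≤ w := Real.one_le_sqrt.2 hcr
  have hw0 : 0 < w := one_pos.trans_le hw1
  have hww : w ^ 2 = c := Real.sq_sqrt (by linarith)
  set μ : ℝ := T * a with hμ
  have hμ0 : 0 < μ := mul_pos hTr ha
  -- `s` is the point at which the majorant `(z + s) ^ 2 / (4 * s)` of `max z 0` is tangent.
  set s : ℝ := (c - μ) + μ / w with hs
  have hs0 : 0 < s := add_pos_of_nonneg_of_pos (sub_nonneg.2 hTa) (div_pos hμ0 hw0)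
  have hq : ∀ m : ℕ, (m : ℝ) - 1 / (4 * s) * (m - c + s) ^ 2 ≤ min (m : ℝ) c := by
    intro m
    refine le_min ?_ ?_
    · have : 0 ≤ 1 / (4 * s) * ((m : ℝ) - c + s) ^ 2 := by positivity
      linarith
    · have : (m : ℝ) - c ≤ 1 / (4 * s) * (m - c + s) ^ 2 := by
        rw [one_div_mul_eq_div, le_div_iff₀ (by positivity)]
        nlinarith [sq_nonneg ((m : ℝ) - c - s)]
      linarith
  have h := le_capStep_iterate ha.le ha1 c s (1 / (4 * s)) (f := fun m : ℕ => min (m : ℝ) c)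
    (by
      intro m hm
      have h1 : (c : ℝ) ≤ m := by exact_mod_cast hm
      simp only [Nat.cast_add, Nat.cast_one]
      rw [min_eq_right h1, min_eq_right (by linarith)]) hq T 0
  refine le_trans ?_ h
  rw [← hμ]
  have hvar : μ * (1 - a) ≤ μ := by nlinarith
  have hbound : 1 / (4 * s) * ((((0 : ℕ) : ℝ) + μ - c + s) ^ 2 + μ * (1 - a)) ≤ μ / (2 * w) := by
    have hsq : ((0 : ℕ) : ℝ) + μ - c + s = μ / w := by
      rw [hs]
      push_cast
      ring
    rw [hsq, one_div_mul_eq_div, div_le_div_iff₀ (by positivity) (by positivity)]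
    have hd : 0 ≤ w ^ 2 - μ := by
      rw [hww]
      linarith
    -- After clearing denominators the claim is `(c - μ) * (2 * w - 1) ≥ 0`.
    have hmain : (μ / w) ^ 2 + μ ≤ 2 * s * (μ / w) := by
      rw [hs, ← hww]
      have : 2 * (w ^ 2 - μ + μ / w) * (μ / w) - ((μ / w) ^ 2 + μ) =
          μ / w ^ 2 * ((w ^ 2 - μ) * (2 * w - 1)) := by
        field_simp
        ring
      have : 0 ≤ μ / w ^ 2 * ((w ^ 2 - μ) * (2 * w - 1)) :=
        mul_nonneg (by positivity) (mul_nonneg hd (by linarith))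
      linarith
    calc ((μ / w) ^ 2 + μ * (1 - a)) * (2 * w) ≤ (2 * s * (μ / w)) * (2 * w) := by
          refine mul_le_mul_of_nonneg_right ?_ (by positivity)
          linarith
      _ = μ * (4 * s) := by
          field_simp
          ring
  have : (1 - 1 / (2 * w)) * μ = μ - μ / (2 * w) := by
    field_simp
  rw [this]
  push_cast at hbound ⊢
  linarith

/-! ### Feasibility and performance of capped policies -/

theorem Data.UpperFeasible.eq_of_pos {D : Data n} {x₀ : ℝ} {x : Fin n → ℝ}
    (hx : D.UpperFeasible 1 x₀ x) {i j : Fin n} (hi : 0 < x i) (hj : 0 < x j) : x i = x j :=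
  (balanced_one_iff hx.nonneg).1 hx.balanced i j hi hj

theorem Data.cBar_le (D : Data n) {x : Fin n → ℝ} {i : Fin n} (hi : 0 < x i) :
    D.cBar x ≤ D.c i :=
  Nat.sInf_le ⟨i, hi, rfl⟩

theorem Data.exists_cBar_eq (D : Data n) {x : Fin n → ℝ} {i : Fin n} (hi : 0 < x i) :
    ∃ j, 0 < x j ∧ D.c j = D.cBar x :=
  Nat.sInf_mem (s := {m | ∃ i, 0 < x i ∧ D.c i = m}) ⟨_, i, hi, rfl⟩

theorem capStep_zero_iterate (c t : ℕ) (f : ℕ → ℝ) : (capStep 0 c)^[t] f = f := by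
  have h : capStep 0 c f = f := by
    funext m
    simp [capStep]
  exact Function.iterate_fixed h t

theorem Data.IsCapped.dynamicFeasible {D : Data n} {x₀ : ℝ} {x : Fin n → ℝ}
    (hx : D.UpperFeasible 1 x₀ x) {p : Policy n} (hp : D.IsCapped x p) :
    D.DynamicFeasible 1 p := by
  constructor
  · intro i
    refine toOuterMeasure_eq_one_of_mean_eq_zero _
      (f := fun h => if sales h i ≤ D.c i then (0 : ℝ) else 1) ?_ ?_ ?_
    · intro h
      split_ifs <;> norm_num
    · intro h hh
      exact one_pos.trans_eq (if_neg hh).symm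
    · rw [hp.mean_sales i le_rfl fun m => if m ≤ D.c i then (0 : ℝ) else 1]
      refine capStep_iterate_eq_zero (k := D.c i) ?_ (fun m hm => if_pos hm) _ 0 (Nat.zero_le _)
      rcases (hx.nonneg i).eq_or_lt with h0 | h0
      · exact Or.inr h0.symm
      · exact Or.inl (D.cBar_le h0)
  · rw [balanced_one_iff (D.expectedSales_nonneg p)]
    have h : ∀ i, D.expectedSales p i = (capStep (x i) (D.cBar x))^[D.T] (fun m => (m : ℝ)) 0 :=
      fun i => hp.mean_sales i le_rfl _
    have hpos : ∀ i, 0 < D.expectedSales p i → 0 < x i := by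
      intro i hi
      refine (hx.nonneg i).lt_of_ne fun h0 => hi.ne' ?_
      rw [h, ← h0, capStep_zero_iterate, Nat.cast_zero]
    intro i j hi hj
    rw [h, h, hx.eq_of_pos (hpos i hi) (hpos j hj)]

theorem Data.UpperFeasible.le_one {D : Data n} {α x₀ : ℝ} {x : Fin n → ℝ}
    (hx : D.UpperFeasible α x₀ x) (i : Fin n) : x i ≤ 1 := by
  have := Finset.single_le_sum (fun j _ => hx.nonneg j) (Finset.mem_univ i)
  have := hx.total
  have := hx.pos
  linarith

theorem Data.IsCapped.le_expectedSales {D : Data n} {x₀ : ℝ} {x : Fin n → ℝ}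
    (hx : D.UpperFeasible 1 x₀ x) {p : Policy n} (hp : D.IsCapped x p) (i : Fin n) :
    max (1 / 2) (1 - 1 / √(D.cMin : ℝ)) * (D.T * x i) ≤ D.expectedSales p i := by
  rcases (hx.nonneg i).eq_or_lt with h0 | h0
  · rw [← h0, mul_zero, mul_zero]
    exact D.expectedSales_nonneg p i
  have hT : (0 : ℝ) < D.T := Nat.cast_pos.2 D.T_pos
  obtain ⟨j, hj, hcj⟩ := D.exists_cBar_eq h0
  have hc : 0 < D.cBar x := hcj ▸ D.c_pos j
  have hTx : D.T * x i ≤ D.cBar x := by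
    have := hx.le_inventory j
    rwa [hcj, ← hx.eq_of_pos h0 hj, le_div_iff₀ hT, mul_comm] at this
  have hmin : D.cMin ≤ D.cBar x := Nat.sInf_le ⟨j, hcj⟩
  have hmin0 : 0 < D.cMin := by
    obtain ⟨k, hk⟩ := Nat.sInf_mem (s := {m | ∃ i, D.c i = m}) ⟨_, i, rfl⟩
    exact (D.c_pos k).trans_eq hk
  have h1 : 1 ≤ √(D.cMin : ℝ) := Real.one_le_sqrt.2 (by exact_mod_cast hmin0)
  have h2 : √(D.cMin : ℝ) ≤ √(D.cBar x : ℝ) := Real.sqrt_le_sqrt (by exact_mod_cast hmin)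
  have hθ : max (1 / 2) (1 - 1 / √(D.cMin : ℝ)) ≤ 1 - 1 / (2 * √(D.cBar x : ℝ)) := by
    refine max_le ?_ ?_
    · have : 1 / (2 * √(D.cBar x : ℝ)) ≤ 1 / 2 :=
        one_div_le_one_div_of_le (by norm_num) (by linarith)
      linarith
    · have : 1 / (2 * √(D.cBar x : ℝ)) ≤ 1 / √(D.cMin : ℝ) :=
        one_div_le_one_div_of_le (by linarith) (by linarith)
      linarith
  refine (mul_le_mul_of_nonneg_right hθ (by positivity)).trans ?_
  refine (mul_le_capStep_iterate h0 (hx.le_one i) hc D.T_pos hTx).trans ?_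
  rw [← hp.mean_sales i le_rfl]
  exact mean_mono _ fun h => min_le_left _ _

theorem Data.IsCapped.dynamicApprox {D : Data n} {x₀ : ℝ} {x : Fin n → ℝ}
    (hx : D.UpperOptimal 1 x₀ x) {p : Policy n} (hp : D.IsCapped x p) :
    D.DynamicApprox 1 (max (1 / 2) (1 - 1 / √(D.cMin : ℝ))) p := by
  refine ⟨hp.dynamicFeasible hx.feasible, fun p' hp' => ?_⟩
  have hθ : (0 : ℝ) ≤ max (1 / 2) (1 - 1 / √(D.cMin : ℝ)) := le_max_of_le_left (by norm_num)
  refine (mul_le_mul_of_nonneg_left (hx.revenue_le hp') hθ).trans ?_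
  rw [Data.revenue, Finset.mul_sum, Finset.mul_sum]
  refine Finset.sum_le_sum fun i _ => ?_
  have := mul_le_mul_of_nonneg_left (hp.le_expectedSales hx.feasible i) (D.r_pos i).le
  linarith

/-! ### The enumeration algorithm -/

theorem Data.grid_pos (D : Data n) {a : ℝ} (ha : a ∈ D.grid) : 0 < a := by
  rcases ha with ⟨i, rfl⟩ | ⟨i, l, _, rfl⟩
  · exact div_pos (Nat.cast_pos.2 (D.c_pos i)) (Nat.cast_pos.2 D.T_pos)
  · have := D.v_pos i
    positivity

theorem Data.grid_finite (D : Data n) : D.grid.Finite := by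
  refine Set.Finite.union ?_ ?_
  · refine (Set.finite_range fun i => (D.c i : ℝ) / D.T).subset ?_
    rintro _ ⟨i, rfl⟩
    exact ⟨i, rfl⟩
  · refine ((Set.finite_univ (α := Fin n)).prod (Finset.Icc 1 n).finite_toSet).image
      (fun q : Fin n × ℕ => D.v q.1 / (1 + (q.2 : ℝ) * D.v q.1)) |>.subset ?_
    rintro _ ⟨i, l, hl, rfl⟩
    exact ⟨(i, l), ⟨Set.mem_univ _, hl⟩, rfl⟩

theorem Data.exists_isTop (D : Data n) (S : Finset (Fin n)) {k : ℕ} (hk : k ≤ S.card) :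
    ∃ A, D.IsTop S k A := by
  induction k with
  | zero => exact ⟨∅, by simp [Data.IsTop]⟩
  | succ k ih =>
    obtain ⟨A, hAS, hAk, hA⟩ := ih (by omega)
    have hne : (S \ A).Nonempty := by
      rw [← Finset.card_pos, Finset.card_sdiff_of_subset hAS]
      omega
    obtain ⟨m, hm, hmax⟩ := (S \ A).exists_max_image D.r hne
    rw [Finset.mem_sdiff] at hm
    refine ⟨insert m A, Finset.insert_subset hm.1 hAS, ?_, ?_⟩
    · rw [Finset.card_insert_of_notMem hm.2, hAk]
    · intro i hi j hj hjA
      rw [Finset.mem_insert, not_or] at hjA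
      rcases Finset.mem_insert.1 hi with rfl | hi
      · exact hmax j (Finset.mem_sdiff.2 ⟨hj, hjA.2⟩)
      · exact hA i hi j hj hjA.2

/-- The elements of `A` outside `B` and those of `B` outside `A` are equally many, and every
revenue of the former is at least every revenue of the latter. -/
theorem Data.IsTop.sum_le {D : Data n} {S A B : Finset (Fin n)} {k : ℕ} (hA : D.IsTop S k A)
    (hB : B ⊆ S) (hBk : B.card = k) : ∑ i ∈ B, D.r i ≤ ∑ i ∈ A, D.r i := by
  rw [← Finset.sum_inter_add_sum_sdiff B A, ← Finset.sum_inter_add_sum_sdiff A B,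
    Finset.inter_comm B A]
  refine add_le_add le_rfl ?_
  have hcard : (B \ A).card = (A \ B).card := by
    have h1 := Finset.card_inter_add_card_sdiff A B
    have h2 := Finset.card_inter_add_card_sdiff B A
    rw [Finset.inter_comm] at h2
    have h3 := hA.2.1
    omega
  rcases (B \ A).eq_empty_or_nonempty with h0 | hne
  · rw [h0, Finset.sum_empty]
    exact Finset.sum_nonneg fun i _ => (D.r_pos i).le
  obtain ⟨m, hm, hmax⟩ := (B \ A).exists_max_image D.r hne
  rw [Finset.mem_sdiff] at hm
  refine (Finset.sum_le_card_nsmul _ _ _ hmax).trans ?_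
  rw [hcard]
  refine Finset.card_nsmul_le_sum _ _ _ fun i hi => ?_
  exact hA.2.2 i (Finset.mem_sdiff.1 hi).1 m (hB hm.1) hm.2

theorem Data.exists_enumOutput (D : Data n) (hn : 0 < n) : ∃ x, D.EnumOutput x := by
  choose top htop using fun (a : ℝ) (k : ℕ) (hk : k ≤ (D.eligible a k).card) =>
    D.exists_isTop (D.eligible a k) hk
  classical
  set top' : ℝ → ℕ → Finset (Fin n) := fun a k =>
    if hk : k ≤ (D.eligible a k).card then top a k hk else ∅ with htop'
  have hrule : D.IsTopRule top' := by
    intro a k hk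
    simp only [htop', dif_pos hk]
    exact htop a k hk
  have hne : (D.grid ×ˢ (↑(Finset.Icc 1 n) : Set ℕ)).Nonempty :=
    ⟨((D.c ⟨0, hn⟩ : ℝ) / D.T, 1), Or.inl ⟨_, rfl⟩, by simp; omega⟩
  obtain ⟨⟨a, k⟩, ⟨ha, hk⟩, hmax⟩ := Set.exists_max_image _
    (fun q : ℝ × ℕ => ∑ i, D.r i * D.candidate top' q.1 q.2 i)
    (D.grid_finite.prod (Finset.Icc 1 n).finite_toSet) hne
  exact ⟨_, top', hrule, a, ha, k, hk, rfl, fun a' ha' k' hk' => hmax (a', k') ⟨ha', hk'⟩⟩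

theorem Data.upperFeasible_zero (D : Data n) {α : ℝ} :
    D.UpperFeasible α (1 - ∑ _i : Fin n, (0 : ℝ)) (fun _ => 0) where
  total := by simp
  nonneg _ := le_rfl
  le_weight i := by simpa using (D.v_pos i).le
  le_inventory _ := by positivity
  balanced _ := Or.inl rfl

theorem Data.mem_eligible (D : Data n) {a : ℝ} {k : ℕ} {i : Fin n} :
    i ∈ D.eligible a k ↔ (D.T : ℝ) * a ≤ D.c i ∧ a / (1 - (k : ℝ) * a) ≤ D.v i := by
  simp [Data.eligible]

theorem Data.upperFeasible_candidate (D : Data n) {top : ℝ → ℕ → Finset (Fin n)}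
    (htop : D.IsTopRule top) {a : ℝ} (ha : 0 < a) (k : ℕ) :
    D.UpperFeasible 1 (1 - ∑ i, D.candidate top a k i) (D.candidate top a k) := by
  have hT : (0 : ℝ) < D.T := Nat.cast_pos.2 D.T_pos
  unfold Data.candidate
  split_ifs with h1 h2
  · exact D.upperFeasible_zero
  · exact D.upperFeasible_zero
  rw [not_le] at h1
  rw [not_lt] at h2
  obtain ⟨hsub, hcard, -⟩ := htop a k h2
  have hsum : ∑ i, (if i ∈ top a k then a else 0) = k * a := by
    rw [Finset.sum_ite_mem, Finset.univ_inter, Finset.sum_const, hcard, nsmul_eq_mul]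
  have hnn : ∀ i, 0 ≤ if i ∈ top a k then a else 0 := by
    intro i
    split_ifs
    exacts [ha.le, le_rfl]
  refine ⟨by ring, hnn, fun i => ?_, fun i => ?_, ?_⟩
  · rw [hsum]
    split_ifs with hi
    · exact (div_le_iff₀ (by linarith)).1 (D.mem_eligible.1 (hsub hi)).2
    · exact mul_nonneg (D.v_pos i).le (by linarith)
  · split_ifs with hi
    · rw [le_div_iff₀ hT, mul_comm]
      exact (D.mem_eligible.1 (hsub hi)).1
    · positivity
  · rw [balanced_one_iff hnn]
    intro i j hi hj
    split_ifs at hi hj ⊢ <;> first | rfl | exact absurd ‹(0 : ℝ) < 0› (lt_irrefl _)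

/-- A feasible vector is constant on its support `A`. Raising that constant until a capacity or
weight constraint of a product in `A` binds leads to a grid value `a`, for which all of `A` is
eligible; the top `A.card` eligible products then earn at least as much as `A`. -/
theorem Data.exists_candidate_ge (D : Data n) {top : ℝ → ℕ → Finset (Fin n)}
    (htop : D.IsTopRule top) {y₀ : ℝ} {y : Fin n → ℝ} (hy : D.UpperFeasible 1 y₀ y)
    {i₀ : Fin n} (hi₀ : 0 < y i₀) :
    ∃ a ∈ D.grid, ∃ k ∈ Finset.Icc 1 n,
      ∑ i, D.r i * y i ≤ ∑ i, D.r i * D.candidate top a k i := by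
  classical
  have hT : (0 : ℝ) < D.T := Nat.cast_pos.2 D.T_pos
  set b := y i₀ with hb
  set A : Finset (Fin n) := Finset.univ.filter fun i => 0 < y i with hA
  have hmem : ∀ i, i ∈ A ↔ 0 < y i := fun i => by simp [hA]
  have hyA : ∀ i, y i = if i ∈ A then b else 0 := by
    intro i
    split_ifs with hi
    · exact hy.eq_of_pos ((hmem i).1 hi) hi₀
    · exact le_antisymm (not_lt.1 fun h => hi ((hmem i).2 h)) (hy.nonneg i)
  set k := A.card with hk
  have hAne : A.Nonempty := ⟨i₀, (hmem i₀).2 hi₀⟩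
  have hk1 : 1 ≤ k := hAne.card_pos
  have hkn : k ≤ n := (Finset.card_le_univ A).trans_eq (Fintype.card_fin n)
  have hkI : k ∈ Finset.Icc 1 n := Finset.mem_Icc.2 ⟨hk1, hkn⟩
  have hysum : ∑ i, y i = k * b := by
    rw [Finset.sum_congr rfl fun i _ => hyA i, Finset.sum_ite_mem, Finset.univ_inter,
      Finset.sum_const, nsmul_eq_mul]
  set g : Fin n → ℝ := fun i => min ((D.c i : ℝ) / D.T) (D.v i / (1 + (k : ℝ) * D.v i)) with hg
  have hden : ∀ i, 0 < 1 + (k : ℝ) * D.v i := fun i =>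
    add_pos_of_pos_of_nonneg one_pos (mul_nonneg (Nat.cast_nonneg _) (D.v_pos i).le)
  obtain ⟨m, hm, hmin⟩ := A.exists_min_image g hAne
  have hgrid : g m ∈ D.grid := by
    rcases min_choice ((D.c m : ℝ) / D.T) (D.v m / (1 + (k : ℝ) * D.v m)) with h | h
    · exact Or.inl ⟨m, h⟩
    · exact Or.inr ⟨m, k, hkI, h⟩
  have hka : (k : ℝ) * g m < 1 := by
    have h1 : (k : ℝ) * g m ≤ k * (D.v m / (1 + (k : ℝ) * D.v m)) :=
      mul_le_mul_of_nonneg_left (min_le_right _ _) (Nat.cast_nonneg _)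
    refine h1.trans_lt ?_
    rw [← mul_div_assoc, div_lt_one (hden m)]
    linarith
  have hbg : b ≤ g m := by
    have hym : y m = b := (hyA m).trans (if_pos hm)
    refine le_min (hym ▸ hy.le_inventory m) ?_
    have h1 := hy.le_weight m
    have h2 := hy.total
    rw [hysum] at h2
    rw [hym, show y₀ = 1 - k * b by linarith] at h1
    rw [le_div_iff₀ (hden m)]
    linarith
  have hAS : A ⊆ D.eligible (g m) k := by
    intro i hi
    have hgi := hmin i hi
    refine D.mem_eligible.2 ⟨?_, ?_⟩
    · rw [mul_comm, ← le_div_iff₀ hT]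
      exact hgi.trans (min_le_left _ _)
    · rw [div_le_iff₀ (by linarith)]
      have := (le_div_iff₀ (hden i)).1 (hgi.trans (min_le_right _ _))
      linarith
  have hcard := Finset.card_le_card hAS
  refine ⟨g m, hgrid, k, hkI, ?_⟩
  have hcand : ∀ i, D.candidate top (g m) k i = if i ∈ top (g m) k then g m else 0 := by
    intro i
    rw [Data.candidate, if_neg hka.not_ge, if_neg hcard.not_gt]
  have hsum : ∀ (B : Finset (Fin n)) (z : ℝ),
      ∑ i, D.r i * (if i ∈ B then z else 0) = (∑ i ∈ B, D.r i) * z := by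
    intro B z
    simp only [mul_ite, mul_zero, Finset.sum_ite_mem, Finset.univ_inter, Finset.sum_mul]
  rw [Finset.sum_congr rfl fun i _ => by rw [hyA i], hsum]
  simp only [hcand]
  rw [hsum]
  exact mul_le_mul ((htop (g m) k hcard).sum_le hAS rfl) hbg hi₀.le
    (Finset.sum_nonneg fun i _ => (D.r_pos i).le)

theorem Data.EnumOutput.upperOptimal {D : Data n} {x : Fin n → ℝ} (hx : D.EnumOutput x) :
    D.UpperOptimal 1 (1 - ∑ i, x i) x := by
  obtain ⟨top, htop, a, ha, k, -, rfl, hmax⟩ := hx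
  have hfeas := D.upperFeasible_candidate htop (D.grid_pos ha) k
  refine ⟨hfeas, fun y₀ y hy => mul_le_mul_of_nonneg_left ?_ (Nat.cast_nonneg _)⟩
  by_cases h : ∃ i₀, 0 < y i₀
  · obtain ⟨i₀, hi₀⟩ := h
    obtain ⟨a', ha', k', hk', hle⟩ := D.exists_candidate_ge htop hy hi₀
    exact hle.trans (hmax a' ha' k' hk')
  · push Not at h
    exact (Finset.sum_nonpos fun i _ => mul_nonpos_of_nonneg_of_nonpos (D.r_pos i).le (h i)).trans
      (Finset.sum_nonneg fun i _ => mul_nonneg (D.r_pos i).le (hfeas.nonneg i))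

end BMS

theorem theorem5 {n : ℕ} (hn : 0 < n) (D : BMS.Data n) :
    (∃ x : Fin n → ℝ, D.EnumOutput x) ∧
    (∀ x : Fin n → ℝ, D.EnumOutput x → D.UpperOptimal 1 (1 - ∑ i, x i) x) ∧
    (∀ (x₀ : ℝ) (x : Fin n → ℝ), D.UpperOptimal 1 x₀ x →
      (∃ p : BMS.Policy n, D.IsCapped x p) ∧
      ∀ p : BMS.Policy n, D.IsCapped x p →
        D.DynamicApprox 1 (max (1 / 2) (1 - 1 / Real.sqrt (D.cMin : ℝ))) p) := by
  refine ⟨D.exists_enumOutput hn, fun x hx => hx.upperOptimal, fun x₀ x hx => ?_⟩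
  exact ⟨hx.feasible.exists_isCapped, fun p hp => hp.dynamicApprox hx⟩
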